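/- Let $n,s>0$ and let $M$ be a smooth manifold of dimension $2n+s$ (without boundary) with a Riemannian metric $g$, its Levi-Civita connection $\nabla$ and curvature $R_{X,Y}=\nabla_X\nabla_Y-\nabla_Y\nabla_X-\nabla_{[X,Y]}$. Let $(f,Q,\xi_i,\eta^i,g)_{1\le i\le s}$ be a weak almost $\mathcal S$-structure on $M$: $f$ is a smooth $(1,1)$-tensor of rank $2n$, $Q$ is a smooth non-singular $(1,1)$-tensor, $\xi_1,\dots,\xi_s$ are smooth vector fields and $\eta^1,\dots,\eta^s$ are smooth $1$-forms with $$f^2=-Q+\sum_i\eta^i\otimes\xi_i,\qquad \eta^i(\xi_j)=\delta^i_j,\qquad Q\xi_i=\xi_i,$$ $$g(fX,fY)=g(X,QY)-\sum_i\eta^i(X)\eta^i(Y),\qquad d\eta^1(X,Y)=\dots=d\eta^s(X,Y)=g(X,fY)$$ for all vector fields $X,Y$, where $d\eta^i(X,Y)=\tfrac12\{X(\eta^i(Y))-Y(\eta^i(X))-\eta^i([X,Y])\}$. Put $h_i=\tfrac12\,\pounds_{\xi_i}f$, that is, $h_iX=\tfrac12([\xi_i,fX]-f[\xi_i,X])$.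 Assume that $\pounds_{\xi_i}Q=0$ for $i=1,\dots,s$. Then for all $i,j\in\{1,\dots,s\}$ and every smooth vector field $X$ on $M$: \begin{align*} (\nabla_{\xi_i}h_j)X&=f R_{\xi_i,X}\xi_j+f h_iX-f h_jX+QfX-f\,Q^{-1}h_jh_iX,\\ (\nabla_{\xi_i}h_i)X&=f R_{\xi_i,X}\xi_i+QfX-f\,Q^{-1}h_i^2X,\\ Q R_{\xi_i,X}\xi_j-f R_{\xi_i,fX}\xi_j&=2\,(h_jh_iX+Qf^2X),\\ Q R_{\xi_i,X}\xi_i-f R_{\xi_i,fX}\xi_i&=2\,(h_i^2X+Qf^2X). \end{align*} -/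

import Mathlib

open scoped Manifold ContDiff Bundle
open Bundle

noncomputable section

/-! ### Tensor calculus on vector fields -/

section Calculus

variable {E : Type*} [NormedAddCommGroup E] [NormedSpace ℝ E]
  {H : Type*} [TopologicalSpace H] (I : ModelWithCorners ℝ E H)
  {M : Type*} [TopologicalSpace M] [ChartedSpace H M]

/-- A vector field on `M` (no regularity imposed). -/
abbrev VField (_I : ModelWithCorners ℝ E H) (M : Type*) [TopologicalSpace M] [ChartedSpace H M] :
    Type _ :=
  Π x : M, TangentSpace _I x

/-- `X` is a smooth vector field. -/
def SmoothVField [IsManifold I ∞ M] (X : VField I M) : Prop :=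
  ContMDiff I I.tangent ∞ (fun x ↦ (⟨x, X x⟩ : TangentBundle I M))

/-- A `(1,1)`-tensor field, that is, a section of `End(TM)`, acting on a vector field. -/
def applyEndo (T : Π x : M, TangentSpace I x →L[ℝ] TangentSpace I x) (X : VField I M) :
    VField I M :=
  fun x ↦ T x (X x)

/-- The Lie derivative of a `(1,1)`-tensor field `T` along `ξ`:
`(£_ξ T) X = [ξ, T X] - T [ξ, X]`. -/
def lieDerivEndo (ξ : VField I M) (T : Π x : M, TangentSpace I x →L[ℝ] TangentSpace I x)
    (X : VField I M) : VField I M :=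
  fun x ↦ VectorField.mlieBracket I ξ (applyEndo I T X) x - T x (VectorField.mlieBracket I ξ X x)

/-- The exterior derivative of a 1-form, with the factor `1/2`:
`dα(X, Y) = (1/2) { X (α(Y)) - Y (α(X)) - α([X, Y]) }`. -/
def extDerivOneForm (α : Π x : M, TangentSpace I x →L[ℝ] ℝ) (X Y : VField I M) (x : M) : ℝ :=
  (1 / 2 : ℝ) * ((mvfderiv I (fun y ↦ α y (Y y)) x) (X x) - (mvfderiv I (fun y ↦ α y (X y)) x) (Y x)
    - α x (VectorField.mlieBracket I X Y x))

variable {I} [IsManifold I ∞ M]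

/-- The vector field `∇_X Y`. -/
def covDeriv (nabla : CovariantDerivative I E (TangentSpace I : M → Type _))
    (X Y : VField I M) : VField I M :=
  fun x ↦ nabla Y x (X x)

/-- The covariant derivative of a `(1,1)`-tensor, seen as an operator `T` on vector fields:
`(∇_X T) Y = ∇_X (T Y) - T (∇_X Y)`. -/
def covDerivEndo (nabla : CovariantDerivative I E (TangentSpace I : M → Type _))
    (X : VField I M) (T : VField I M → VField I M) (Y : VField I M) : VField I M :=
  covDeriv nabla X (T Y) - T (covDeriv nabla X Y)

/-- The curvature `R_{X,Y} Z = ∇_X ∇_Y Z - ∇_Y ∇_X Z - ∇_{[X,Y]} Z`. -/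
def curvature (nabla : CovariantDerivative I E (TangentSpace I : M → Type _))
    (X Y Z : VField I M) : VField I M :=
  covDeriv nabla X (covDeriv nabla Y Z) - covDeriv nabla Y (covDeriv nabla X Z)
    - covDeriv nabla (VectorField.mlieBracket I X Y) Z

end Calculus

/-! ### Riemannian metrics and the Levi-Civita connection -/

section LeviCivita

variable {E : Type*} [NormedAddCommGroup E] [NormedSpace ℝ E]
  {H : Type*} [TopologicalSpace H] {I : ModelWithCorners ℝ E H}
  {M : Type*} [TopologicalSpace M] [ChartedSpace H M] [IsManifold I ∞ M]

/-- A smooth Riemannian metric on `M`. -/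
abbrev RMetric (I : ModelWithCorners ℝ E H) (M : Type*) [TopologicalSpace M] [ChartedSpace H M]
    [IsManifold I ∞ M] : Type _ :=
  ContMDiffRiemannianMetric I ∞ E (fun x : M ↦ TangentSpace I x)

namespace RMetric

variable (g : RMetric I M)

/-- `∇` is the Levi-Civita connection of `g`: it is torsion-free and metric. -/
def IsLeviCivita (nabla : CovariantDerivative I E (TangentSpace I : M → Type _)) : Prop :=
  ∀ (X Y : Π x : M, TangentSpace I x) (x : M), MDiffAt (T% X) x → MDiffAt (T% Y) x →
    (nabla Y x (X x) - nabla X x (Y x) = VectorField.mlieBracket I X Y x) ∧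
    ∀ v : TangentSpace I x, mvfderiv I (fun y ↦ g.inner y (X y) (Y y)) x v =
        g.inner x (nabla X x v) (Y x) + g.inner x (X x) (nabla Y x v)

theorem mdiffAt {X Y : Π x : M, TangentSpace I x} {x : M}
    (hX : MDiffAt (T% X) x) (hY : MDiffAt (T% Y) x) :
    MDiffAt (fun y ↦ g.inner y (X y) (Y y)) x := by
  let _ : RiemannianBundle (fun x : M ↦ TangentSpace I x) := ⟨g.toRiemannianMetric⟩
  have : IsContMDiffRiemannianBundle I 1 E (fun x : M ↦ TangentSpace I x) :=
    IsContMDiffRiemannianBundle.of_le (n := ∞) (by exact_mod_cast le_top)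
  exact MDifferentiableAt.inner_bundle (E := fun x : M ↦ TangentSpace I x) hX hY

/-- The right-hand side of the Koszul formula for `g(∇_X Y, Z)`. -/
def koszul (Y X Z : Π x : M, TangentSpace I x) (x : M) : ℝ :=
  (1 / 2 : ℝ) * (mvfderiv I (fun y ↦ g.inner y (Y y) (Z y)) x (X x)
    + mvfderiv I (fun y ↦ g.inner y (X y) (Z y)) x (Y x)
    - mvfderiv I (fun y ↦ g.inner y (X y) (Y y)) x (Z x)
    + g.inner x (VectorField.mlieBracket I X Y x) (Z x)
    - g.inner x (VectorField.mlieBracket I X Z x) (Y x)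
    - g.inner x (VectorField.mlieBracket I Y Z x) (X x))

section rules
variable {X X' Y Y' : Π x : M, TangentSpace I x} {x : M} {a : M → ℝ}

theorem d_add_left (hX : MDiffAt (T% X) x) (hX' : MDiffAt (T% X') x) (hY : MDiffAt (T% Y) x)
    (v : TangentSpace I x) :
    mvfderiv I (fun y ↦ g.inner y ((X + X') y) (Y y)) x v =
      mvfderiv I (fun y ↦ g.inner y (X y) (Y y)) x v
        + mvfderiv I (fun y ↦ g.inner y (X' y) (Y y)) x v := by
  have := mvfderiv_fun_add (g.mdiffAt hX hY) (g.mdiffAt hX' hY)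
  simp only [Pi.add_apply, map_add, add_apply]
  rw [this]; rfl

theorem d_smul_left (ha : MDiffAt a x) (hX : MDiffAt (T% X) x) (hY : MDiffAt (T% Y) x)
    (v : TangentSpace I x) :
    mvfderiv I (fun y ↦ g.inner y ((a • X) y) (Y y)) x v =
      a x * mvfderiv I (fun y ↦ g.inner y (X y) (Y y)) x v
        + mvfderiv I a x v * g.inner x (X x) (Y x) := by
  have := mvfderiv_fun_mul ha (g.mdiffAt hX hY)
  simp only [Pi.smul_apply', map_smul, smul_apply, smul_eq_mul]
  rw [this]; simp [mul_comm]

theorem d_symm (X Y : Π x : M, TangentSpace I x) :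
    (fun y ↦ g.inner y (X y) (Y y)) = fun y ↦ g.inner y (Y y) (X y) :=
  funext fun y ↦ g.symm y _ _

theorem d_add_right (hX : MDiffAt (T% X) x) (hX' : MDiffAt (T% X') x) (hY : MDiffAt (T% Y) x)
    (v : TangentSpace I x) :
    mvfderiv I (fun y ↦ g.inner y (Y y) ((X + X') y)) x v =
      mvfderiv I (fun y ↦ g.inner y (Y y) (X y)) x v
        + mvfderiv I (fun y ↦ g.inner y (Y y) (X' y)) x v := by
  rw [g.d_symm, g.d_add_left hX hX' hY, g.d_symm X, g.d_symm X']

theorem d_smul_right (ha : MDiffAt a x) (hX : MDiffAt (T% X) x) (hY : MDiffAt (T% Y) x)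
    (v : TangentSpace I x) :
    mvfderiv I (fun y ↦ g.inner y (Y y) ((a • X) y)) x v =
      a x * mvfderiv I (fun y ↦ g.inner y (Y y) (X y)) x v
        + mvfderiv I a x v * g.inner x (Y x) (X x) := by
  rw [g.d_symm, g.d_smul_left ha hX hY, g.d_symm X, g.symm x (X x)]

variable [CompleteSpace E]

theorem koszul_tensorial₁ (hY : MDiffAt (T% Y) x) (Z : Π x : M, TangentSpace I x)
    (hZ : MDiffAt (T% Z) x) : TensorialAt I E (fun X ↦ g.koszul Y X Z x) x where
  smul {a X} ha hX := by
    simp only [koszul, g.d_smul_left ha hX hZ, g.d_smul_left ha hX hY,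
      VectorField.mlieBracket_smul_left ha hX]
    simp only [Pi.smul_apply', map_smul, map_add, add_apply, smul_apply,
      smul_eq_mul]
    ring
  add {X X'} hX hX' := by
    simp only [koszul, g.d_add_left hX hX' hZ, g.d_add_left hX hX' hY,
      VectorField.mlieBracket_add_left hX hX']
    simp only [Pi.add_apply, map_add, add_apply]
    ring

theorem koszul_tensorial₂ (hY : MDiffAt (T% Y) x) (X : Π x : M, TangentSpace I x)
    (hX : MDiffAt (T% X) x) : TensorialAt I E (fun Z ↦ g.koszul Y X Z x) x where
  smul {a Z} ha hZ := by
    simp only [koszul, g.d_smul_right ha hZ hX, g.d_smul_right ha hZ hY,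
      VectorField.mlieBracket_smul_right ha hZ]
    simp only [Pi.smul_apply', map_smul, map_add, add_apply, smul_apply,
      smul_eq_mul]
    rw [g.symm x (Z x) (X x), g.symm x (Z x) (Y x)]
    ring
  add {Z Z'} hZ hZ' := by
    simp only [koszul, g.d_add_right hZ hZ' hX, g.d_add_right hZ hZ' hY,
      VectorField.mlieBracket_add_right hZ hZ']
    simp only [Pi.add_apply, map_add, add_apply]
    ring

end rules

variable [FiniteDimensional ℝ E] [CompleteSpace E]

instance finiteDimensional_tangentSpace (x : M) : FiniteDimensional ℝ (TangentSpace I x) :=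
  inferInstanceAs (FiniteDimensional ℝ E)

instance t2Space_tangentSpace (x : M) : T2Space (TangentSpace I x) :=
  inferInstanceAs (T2Space E)

/-- The metric at `x`, as a bilinear form. -/
def form (x : M) : LinearMap.BilinForm ℝ (TangentSpace I x) :=
  LinearMap.mk₂ ℝ (fun v w ↦ g.inner x v w) (by simp) (by simp) (by simp) (by simp)

theorem form_nondegenerate (x : M) : (g.form x).Nondegenerate := by
  refine (LinearMap.IsRefl.nondegenerate_iff_separatingLeft ?_).2 ?_
  · intro v w h
    exact (g.symm x w v).trans h
  · intro v hv
    by_contra h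
    exact (g.pos x v h).ne' (hv v)

/-- The musical isomorphism `T_x^* M → T_x M`. -/
def sharp (x : M) : Module.Dual ℝ (TangentSpace I x) ≃ₗ[ℝ] TangentSpace I x :=
  ((g.form x).toDual (g.form_nondegenerate x)).symm

theorem inner_sharp (x : M) (φ : Module.Dual ℝ (TangentSpace I x)) (v : TangentSpace I x) :
    g.inner x (g.sharp x φ) v = φ v := by
  have := (g.form x).apply_toDual_symm_apply (hB := g.form_nondegenerate x) φ v
  exact this

theorem ext_inner {x : M} {u v : TangentSpace I x} (h : ∀ w, g.inner x u w = g.inner x v w) :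
    u = v := by
  by_contra hne
  have := g.pos x (u - v) (sub_ne_zero.2 hne)
  rw [map_sub (g.inner x), sub_apply, h, sub_self] at this
  exact this.false

open Classical in
/-- The covariant derivative given by the Koszul formula (with value `0` where `Y` is not
differentiable). -/
def koszulDeriv (Y : Π x : M, TangentSpace I x) (x : M) :
    TangentSpace I x →L[ℝ] TangentSpace I x :=
  if hY : MDiffAt (T% Y) x then
    LinearMap.toContinuousLinearMap ((g.sharp x).toLinearMap ∘ₗ
      (ContinuousLinearMap.coeLM ℝ : (TangentSpace I x →L[ℝ] ℝ) →ₗ[ℝ] _) ∘ₗ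
      (TensorialAt.mkHom₂ (fun X Z ↦ g.koszul Y X Z x) x
        (g.koszul_tensorial₁ hY) (g.koszul_tensorial₂ hY)).toLinearMap)
  else 0

theorem inner_koszulDeriv {X Y Z : Π x : M, TangentSpace I x} {x : M} (hX : MDiffAt (T% X) x)
    (hY : MDiffAt (T% Y) x) (hZ : MDiffAt (T% Z) x) :
    g.inner x (g.koszulDeriv Y x (X x)) (Z x) = g.koszul Y X Z x := by
  rw [koszulDeriv, dif_pos hY]
  refine (g.inner_sharp x _ _).trans ?_
  exact TensorialAt.mkHom₂_apply (g.koszul_tensorial₁ hY) (g.koszul_tensorial₂ hY) hX hZ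

theorem clm_ext_of_mdiffAt {x : M} {A B : TangentSpace I x →L[ℝ] TangentSpace I x}
    (h : ∀ X Z : Π x : M, TangentSpace I x, MDiffAt (T% X) x → MDiffAt (T% Z) x →
      g.inner x (A (X x)) (Z x) = g.inner x (B (X x)) (Z x)) : A = B := by
  ext v
  refine g.ext_inner fun w ↦ ?_
  simpa using h (FiberBundle.extend E v) (FiberBundle.extend E w)
    (FiberBundle.mdifferentiableAt_extend ..) (FiberBundle.mdifferentiableAt_extend ..)

/-- The Levi-Civita connection of `g`. -/
def leviCivita : CovariantDerivative I E (TangentSpace I : M → Type _) where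
  toFun := g.koszulDeriv
  isCovariantDerivativeOnUniv :=
    { add := by
        intro Y Y' x hY hY' _
        refine g.clm_ext_of_mdiffAt fun X Z hX hZ ↦ ?_
        rw [g.inner_koszulDeriv hX (mdifferentiableAt_add_section hY hY') hZ, add_apply, map_add,
          add_apply, g.inner_koszulDeriv hX hY hZ, g.inner_koszulDeriv hX hY' hZ]
        simp only [koszul, g.d_add_left hY hY' hZ, g.d_add_right hY hY' hX,
          VectorField.mlieBracket_add_left hY hY', VectorField.mlieBracket_add_right hY hY']
        simp only [Pi.add_apply, map_add, add_apply]
        ring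
      leibniz := by
        intro Y a x hY ha _
        refine g.clm_ext_of_mdiffAt fun X Z hX hZ ↦ ?_
        rw [g.inner_koszulDeriv hX (ha.smul_section hY) hZ]
        simp only [add_apply, map_add, smul_apply, map_smul, g.inner_koszulDeriv hX hY hZ,
          ContinuousLinearMap.smulRight_apply]
        simp only [koszul, g.d_smul_left ha hY hZ, g.d_smul_right ha hY hX,
          VectorField.mlieBracket_smul_left ha hY, VectorField.mlieBracket_smul_right ha hY]
        simp only [Pi.smul_apply', map_smul, map_add, add_apply, smul_apply,
          smul_eq_mul]
        rw [g.symm x (X x) (Y x)]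
        ring }

theorem isLeviCivita_leviCivita : g.IsLeviCivita g.leviCivita := by
  intro X Y x hX hY
  constructor
  · refine g.ext_inner fun w ↦ ?_
    have hZ : MDiffAt (T% (FiberBundle.extend E w : Π x : M, TangentSpace I x)) x :=
      FiberBundle.mdifferentiableAt_extend ..
    have h1 := g.inner_koszulDeriv hX hY hZ
    have h2 := g.inner_koszulDeriv hY hX hZ
    simp only [FiberBundle.extend_apply_self] at h1 h2
    rw [map_sub, sub_apply]
    refine (congrArg₂ (· - ·) h1 h2).trans ?_
    simp only [koszul, FiberBundle.extend_apply_self]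
    rw [VectorField.mlieBracket_swap_apply (V := Y) (W := X), g.d_symm Y X]
    simp only [map_neg, neg_apply]
    ring
  · intro w
    have hZ : MDiffAt (T% (FiberBundle.extend E w : Π x : M, TangentSpace I x)) x :=
      FiberBundle.mdifferentiableAt_extend ..
    have h1 := g.inner_koszulDeriv hZ hX hY
    have h2 := g.inner_koszulDeriv hZ hY hX
    simp only [FiberBundle.extend_apply_self] at h1 h2
    rw [g.symm x (X x)]
    refine Eq.trans ?_ (congrArg₂ (· + ·) h1 h2).symm
    simp only [koszul, FiberBundle.extend_apply_self]
    rw [VectorField.mlieBracket_swap_apply (V := Y) (W := X), g.d_symm Y X,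
      g.d_symm _ Y, g.d_symm _ X]
    simp only [map_neg, neg_apply]
    ring

end RMetric
end LeviCivita

/-! ### Weak metric `f`-structures -/

/-- A framed weak `f`-structure `(f, Q, ξ_i, η^i)` on `M`, with `f` of rank `2 n` and `s`
structure vector fields. -/
structure FramedWeakFStructure {E : Type*} [NormedAddCommGroup E] [NormedSpace ℝ E]
    {H : Type*} [TopologicalSpace H] (I : ModelWithCorners ℝ E H)
    (M : Type*) [TopologicalSpace M] [ChartedSpace H M] [IsManifold I ∞ M] (n s : ℕ) where
  f : Π x : M, TangentSpace I x →L[ℝ] TangentSpace I x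
  Q : Π x : M, TangentSpace I x →L[ℝ] TangentSpace I x
  ξ : Fin s → VField I M
  η : Fin s → Π x : M, TangentSpace I x →L[ℝ] ℝ
  smooth_f : ContMDiff I (I.prod 𝓘(ℝ, E →L[ℝ] E)) ∞
    (fun x ↦ TotalSpace.mk' (E →L[ℝ] E) (E := fun x : M ↦ TangentSpace I x →L[ℝ] TangentSpace I x)
      x (f x))
  smooth_Q : ContMDiff I (I.prod 𝓘(ℝ, E →L[ℝ] E)) ∞
    (fun x ↦ TotalSpace.mk' (E →L[ℝ] E) (E := fun x : M ↦ TangentSpace I x →L[ℝ] TangentSpace I x)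
      x (Q x))
  smooth_ξ : ∀ i, SmoothVField I (ξ i)
  smooth_η : ∀ i, ContMDiff I (I.prod 𝓘(ℝ, E →L[ℝ] ℝ)) ∞
    (fun x ↦ TotalSpace.mk' (E →L[ℝ] ℝ) (E := fun x : M ↦ TangentSpace I x →L[ℝ] Trivial M ℝ x)
      x (η i x))
  rank_f : ∀ x, Module.finrank ℝ (LinearMap.range (f x).toLinearMap) = 2 * n
  nonsingular_Q : ∀ x, (Q x).IsInvertible
  f_sq : ∀ (x : M) (v : TangentSpace I x), f x (f x v) = - Q x v + ∑ i, η i x v • ξ i x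
  η_ξ : ∀ (i j : Fin s) (x : M), η i x (ξ j x) = if i = j then 1 else 0
  Q_ξ : ∀ (i : Fin s) (x : M), Q x (ξ i x) = ξ i x

namespace FramedWeakFStructure

variable {E : Type*} [NormedAddCommGroup E] [NormedSpace ℝ E]
  {H : Type*} [TopologicalSpace H] {I : ModelWithCorners ℝ E H}
  {M : Type*} [TopologicalSpace M] [ChartedSpace H M] [IsManifold I ∞ M] {n s : ℕ}
  (S : FramedWeakFStructure I M n s)

/-- The tensor `h_i = (1/2) £_{ξ_i} f`, as an operator on vector fields. -/
def h (i : Fin s) (X : VField I M) : VField I M :=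
  (1 / 2 : ℝ) • lieDerivEndo I (S.ξ i) S.f X

/-- The condition `£_{ξ_i} Q = 0` for all `i`. -/
def LieDerivQEqZero : Prop :=
  ∀ (i : Fin s) (X : VField I M), SmoothVField I X → lieDerivEndo I (S.ξ i) S.Q X = 0

variable (g : RMetric I M)

/-- The Riemannian metric `g` is compatible with the framed weak `f`-structure, i.e. together they form
a weak metric `f`-structure:
`g(f X, f Y) = g(X, Q Y) - ∑ i, η^i(X) η^i(Y)`. -/
def IsCompatible : Prop :=
  ∀ (x : M) (v w : TangentSpace I x),
    g.inner x (S.f x v) (S.f x w) = g.inner x v (S.Q x w) - ∑ i, S.η i x v * S.η i x w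

/-- The fundamental 2-form `Φ(X, Y) = g(X, f Y)`. -/
def Phi (X Y : VField I M) (x : M) : ℝ :=
  g.inner x (X x) (S.f x (Y x))

/-- A weak almost `𝒮`-structure: a weak metric `f`-structure with `Φ = dη^1 = ⋯ = dη^s`. -/
structure IsWeakAlmostS : Prop where
  compatible : S.IsCompatible g
  dη_eq : ∀ (i : Fin s) (X Y : VField I M), SmoothVField I X → SmoothVField I Y →
    ∀ x, extDerivOneForm I (S.η i) X Y x = S.Phi g X Y x

end FramedWeakFStructure

end

/-! ### Smooth vector fields -/

section SmoothFields

variable {E : Type*} [NormedAddCommGroup E] [NormedSpace ℝ E]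
  {H : Type*} [TopologicalSpace H] {I : ModelWithCorners ℝ E H}
  {M : Type*} [TopologicalSpace M] [ChartedSpace H M] [IsManifold I ∞ M]

/-! All four identities follow from relations between `ℝ`-linear operators on smooth vector fields.
Write `l i` for `[ξ_i, ·]`, `p` for `Q⁻¹` and `P = f² + Q = ∑ η^k ⊗ ξ_k`.

Since `dη^k = Φ` is alternating, `f` is skew. Hence `f ξ_i = 0`, `η^i = g(·, ξ_i)` and `η^i ∘ f =
0`, so `fP = Pf = 0`. Contracting `dη^k` with `ξ_i` gives `£_{ξ_i} η^k = 0`. It follows that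
`£_{ξ_i} Φ = 0` and `[ξ_i, ξ_k] = 0`, so `l i` commutes with `P`; it commutes with `Q` by hypothesis
(`weakFRelations`).

The Levi-Civita connection enters only through `A i = ∇ξ_i`. Invariance of `Φ` gives `∇_{fW} ξ_i =
-f²W - h_i W`, and `∇_{ξ_k} ξ_i = 0`; together they yield `A i = -f + h_i p f` (`nabla_ξ`).
Torsion-freeness gives `∇_{ξ_i} = l i + A i`, and therefore `R_{ξ_i,·} ξ_j = (l i + A i) A j - A j
(l i)` (`curvature_ξ`). What remains is noncommutative ring algebra (`nabla_h`, `curvature_sub`). -/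

theorem minSmoothness_natCast_le_infty (k : ℕ) :
    minSmoothness ℝ (k : WithTop ℕ∞) ≤ (∞ : WithTop ℕ∞) := by
  rw [minSmoothness_of_isRCLikeNormedField]
  exact mod_cast le_top (a := (k : ℕ∞))

variable (I M) in
theorem isManifold_minSmoothness (k : ℕ) : IsManifold I (minSmoothness ℝ (k : WithTop ℕ∞)) M :=
  IsManifold.of_le (minSmoothness_natCast_le_infty k)

namespace SmoothVField

variable {X Y : VField I M}

theorem mdiffAt (hX : SmoothVField I X) (x : M) : MDiffAt (T% X) x :=
  ContMDiff.mdifferentiable hX (by simp) x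

theorem sub (hX : SmoothVField I X) (hY : SmoothVField I Y) : SmoothVField I (X - Y) :=
  ContMDiff.sub_section hX hY

theorem smul {u : M → ℝ} (hu : ContMDiff I 𝓘(ℝ) ∞ u) (hX : SmoothVField I X) :
    SmoothVField I (u • X) :=
  ContMDiff.smul_section hu hX

theorem mlieBracket [CompleteSpace E] (hX : SmoothVField I X) (hY : SmoothVField I Y) :
    SmoothVField I (VectorField.mlieBracket I X Y) :=
  have : IsManifold I ((⊤ : ℕ∞) + 1) M := ‹IsManifold I ∞ M›
  have := isManifold_minSmoothness I M 2
  ContDiff.mlieBracket_vectorField (m := ⊤) (n := ⊤) hX hY (by simp)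

theorem applyEndo {T : Π x : M, TangentSpace I x →L[ℝ] TangentSpace I x}
    (hT : ContMDiff I (I.prod 𝓘(ℝ, E →L[ℝ] E)) ∞ (fun x ↦ TotalSpace.mk' (E →L[ℝ] E)
      (E := fun x : M ↦ TangentSpace I x →L[ℝ] TangentSpace I x) x (T x)))
    (hX : SmoothVField I X) : SmoothVField I (applyEndo I T X) :=
  ContMDiff.clm_bundle_apply hT hX

theorem applyForm {α : Π x : M, TangentSpace I x →L[ℝ] ℝ}
    (hα : ContMDiff I (I.prod 𝓘(ℝ, E →L[ℝ] ℝ)) ∞ (fun x ↦ TotalSpace.mk' (E →L[ℝ] ℝ)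
      (E := fun x : M ↦ TangentSpace I x →L[ℝ] Trivial M ℝ x) x (α x)))
    (hX : SmoothVField I X) : ContMDiff I 𝓘(ℝ) ∞ (fun x ↦ α x (X x)) := by
  have : ContMDiff I (I.prod 𝓘(ℝ)) ∞ (fun x ↦ TotalSpace.mk' ℝ (E := Trivial M ℝ) x (α x (X x))) :=
    ContMDiff.clm_bundle_apply (E₂ := Trivial M ℝ) hα hX
  intro x
  exact ((Bundle.contMDiffAt_totalSpace).1 (this x)).2

/-- Every tangent vector is the value of a smooth vector field. -/
theorem exists_eq [FiniteDimensional ℝ E] [T2Space M] {x : M} (v : TangentSpace I x) :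
    ∃ X : VField I M, SmoothVField I X ∧ X x = v := by
  obtain ⟨s, hs, hsσ⟩ := FiberBundle.exists_contMDiffOn_extend (k := ∞) I E (V := TangentSpace I) v
  obtain ⟨t, hts, ht, hxt⟩ := mem_nhds_iff.1 hs
  -- The bump function is supported where the local extension of `v` is smooth, so the product is
  -- globally smooth.
  obtain ⟨φ, -, hφ⟩ := (SmoothBumpFunction.nhds_basis_tsupport (I := I) x).mem_iff.1
    (ht.mem_nhds hxt)
  refine ⟨(φ : M → ℝ) • FiberBundle.extend E v, ?_, ?_⟩
  · exact ContMDiffOn.smul_section_of_tsupport (φ.contMDiff.contMDiffOn) ht hφ (hsσ.mono hts)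
  · simp

end SmoothVField

/-- The pointwise inverse of a smooth field of invertible endomorphisms is smooth. -/
theorem contMDiff_inverse_endo [CompleteSpace E]
    {T : Π x : M, TangentSpace I x →L[ℝ] TangentSpace I x}
    (hT : ContMDiff I (I.prod 𝓘(ℝ, E →L[ℝ] E)) ∞ (fun x ↦ TotalSpace.mk' (E →L[ℝ] E)
      (E := fun x : M ↦ TangentSpace I x →L[ℝ] TangentSpace I x) x (T x)))
    (hinv : ∀ x, (T x).IsInvertible) :
    ContMDiff I (I.prod 𝓘(ℝ, E →L[ℝ] E)) ∞ (fun x ↦ TotalSpace.mk' (E →L[ℝ] E)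
      (E := fun x : M ↦ TangentSpace I x →L[ℝ] TangentSpace I x) x (T x).inverse) := by
  intro x₀
  rw [contMDiffAt_hom_bundle]
  refine ⟨contMDiffAt_id, ?_⟩
  have h1 := ((contMDiffAt_hom_bundle _).1 (hT x₀)).2
  have h0 := FiberBundle.mem_baseSet_trivializationAt' (F := E) (E := TangentSpace I) x₀
  have h2 : ContMDiffAt I 𝓘(ℝ, E →L[ℝ] E) ∞ (ContinuousLinearMap.inverse ∘ fun x : M ↦
      ContinuousLinearMap.inCoordinates E (TangentSpace I (M := M)) E (TangentSpace I (M := M))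
        x₀ x x₀ x (T x)) x₀ := by
    refine ContMDiffAt.comp x₀ (ContDiffAt.contMDiffAt ?_) h1
    apply ContinuousLinearMap.IsInvertible.contDiffAt_map_inverse
    rw [ContinuousLinearMap.inCoordinates_eq h0 h0]
    exact ContinuousLinearMap.isInvertible_equiv.comp
      ((hinv x₀).comp ContinuousLinearMap.isInvertible_equiv)
  refine h2.congr_of_eventuallyEq ?_
  filter_upwards [(trivializationAt E (TangentSpace I) x₀).open_baseSet.mem_nhds h0] with x hx
  simp only [Function.comp_apply]
  rw [ContinuousLinearMap.inCoordinates_eq hx hx, ContinuousLinearMap.inCoordinates_eq hx hx]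
  simp only [ContinuousLinearMap.inverse_equiv_comp, ContinuousLinearMap.inverse_comp_equiv,
    ContinuousLinearEquiv.symm_symm]
  rfl

variable [CompleteSpace E]

/-- The derivative `W u` of a smooth function along a smooth vector field is smooth, provided that
some smooth vector field `Z` is normalized by a smooth `1`-form. -/
theorem contMDiff_mvfderiv_apply {α : Π x : M, TangentSpace I x →L[ℝ] ℝ}
    (hα : ContMDiff I (I.prod 𝓘(ℝ, E →L[ℝ] ℝ)) ∞ (fun x ↦ TotalSpace.mk' (E →L[ℝ] ℝ)
      (E := fun x : M ↦ TangentSpace I x →L[ℝ] Trivial M ℝ x) x (α x)))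
    {Z W : VField I M} (hZ : SmoothVField I Z) (hαZ : ∀ x, α x (Z x) = 1)
    (hW : SmoothVField I W) {u : M → ℝ} (hu : ContMDiff I 𝓘(ℝ) ∞ u) :
    ContMDiff I 𝓘(ℝ) ∞ (fun x ↦ mvfderiv I u x (W x)) := by
  -- `[W, uZ] - u[W, Z] = (Wu) Z`, and `α` reads off the coefficient of `Z`.
  have h := SmoothVField.applyForm hα
    ((hW.mlieBracket (hZ.smul hu)).sub ((hW.mlieBracket hZ).smul hu))
  refine h.congr fun x ↦ ?_
  have := VectorField.mlieBracket_smul_right (V := W)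
    (hu.mdifferentiable (by simp) x) (hZ.mdiffAt x)
  simp [this, hαZ]

theorem leibniz_mlieBracket {X Y Z : VField I M} (hX : SmoothVField I X)
    (hY : SmoothVField I Y) (hZ : SmoothVField I Z) :
    VectorField.mlieBracket I X (VectorField.mlieBracket I Y Z) =
      VectorField.mlieBracket I (VectorField.mlieBracket I X Y) Z
        + VectorField.mlieBracket I Y (VectorField.mlieBracket I X Z) := by
  have h : minSmoothness ℝ ((2 : ℕ) : WithTop ℕ∞) ≤ ∞ := minSmoothness_natCast_le_infty 2
  have := isManifold_minSmoothness I M 3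
  exact VectorField.leibniz_identity_mlieBracket (hX.of_le h) (hY.of_le h) (hZ.of_le h)

/-- The Lie bracket is the commutator of derivations of functions. -/
theorem mvfderiv_mlieBracket {α : Π x : M, TangentSpace I x →L[ℝ] ℝ}
    (hα : ContMDiff I (I.prod 𝓘(ℝ, E →L[ℝ] ℝ)) ∞ (fun x ↦ TotalSpace.mk' (E →L[ℝ] ℝ)
      (E := fun x : M ↦ TangentSpace I x →L[ℝ] Trivial M ℝ x) x (α x)))
    {Z V W : VField I M} (hZ : SmoothVField I Z) (hαZ : ∀ x, α x (Z x) = 1)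
    (hV : SmoothVField I V) (hW : SmoothVField I W) {u : M → ℝ} (hu : ContMDiff I 𝓘(ℝ) ∞ u)
    (x : M) :
    mvfderiv I u x (VectorField.mlieBracket I V W x) =
      mvfderiv I (fun y ↦ mvfderiv I u y (W y)) x (V x)
        - mvfderiv I (fun y ↦ mvfderiv I u y (V y)) x (W x) := by
  have hd : ∀ {a : M → ℝ}, ContMDiff I 𝓘(ℝ) ∞ a → MDiff a := fun ha ↦ ha.mdifferentiable (by simp)
  have hb : ∀ {A B : VField I M} {a : M → ℝ}, ContMDiff I 𝓘(ℝ) ∞ a → SmoothVField I B →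
      VectorField.mlieBracket I A (a • B) =
        (fun y ↦ mvfderiv I a y (A y)) • B + a • VectorField.mlieBracket I A B := by
    intro A B a ha hB
    ext y
    exact VectorField.mlieBracket_smul_right (hd ha y) (hB.mdiffAt y)
  have hVu := contMDiff_mvfderiv_apply hα hZ hαZ hV hu
  have hWu := contMDiff_mvfderiv_apply hα hZ hαZ hW hu
  -- Expand the Jacobi identity for `V, W, uZ` and apply `α`. Terms undifferentiated in `u` cancel
  -- by Jacobi for `V, W, Z`, and the mixed first-order terms match.
  have key := congrFun (leibniz_mlieBracket hV hW (hZ.smul hu)) x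
  have key' := congrFun (leibniz_mlieBracket hV hW hZ) x
  rw [hb hu hZ, hb hu hZ, hb hu hZ] at key
  rw [Pi.add_apply, VectorField.mlieBracket_add_right ((hZ.smul hWu).mdiffAt x)
    (((hW.mlieBracket hZ).smul hu).mdiffAt x), VectorField.mlieBracket_add_right
    ((hZ.smul hVu).mdiffAt x) (((hV.mlieBracket hZ).smul hu).mdiffAt x), hb hWu hZ, hb hVu hZ,
    hb hu (hW.mlieBracket hZ), hb hu (hV.mlieBracket hZ)] at key
  have := congrArg (α x) key
  have key'' := congrArg (α x) key'
  simp only [Pi.add_apply, Pi.smul_apply', map_add, map_smul, hαZ, smul_eq_mul, mul_one]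
    at this key''
  rw [key''] at this
  linarith

end SmoothFields

/-! ### First consequences of the structure equations -/

namespace FramedWeakFStructure

section Structure

variable {E : Type*} [NormedAddCommGroup E] [NormedSpace ℝ E]
  {H : Type*} [TopologicalSpace H] {I : ModelWithCorners ℝ E H}
  {M : Type*} [TopologicalSpace M] [ChartedSpace H M] [IsManifold I ∞ M] {n s : ℕ}
  (S : FramedWeakFStructure I M n s)

theorem smooth_f_apply {X : VField I M} (hX : SmoothVField I X) :
    SmoothVField I (applyEndo I S.f X) :=
  hX.applyEndo S.smooth_f

theorem smooth_η_apply (i : Fin s) {X : VField I M} (hX : SmoothVField I X) :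
    ContMDiff I 𝓘(ℝ) ∞ (fun x ↦ S.η i x (X x)) :=
  hX.applyForm (S.smooth_η i)

theorem η_ξ_self (i : Fin s) (x : M) : S.η i x (S.ξ i x) = 1 := by simp [S.η_ξ]

theorem Q_injective (x : M) : Function.Injective (S.Q x) :=
  ContinuousLinearMap.IsInvertible.injective (S.nonsingular_Q x)

namespace IsWeakAlmostS

variable {S} {g : RMetric I M} (hS : S.IsWeakAlmostS g)
include hS

theorem inner_f_right (i : Fin s) {X Y : VField I M} (hX : SmoothVField I X)
    (hY : SmoothVField I Y) (x : M) :
    g.inner x (X x) (S.f x (Y x)) = - g.inner x (S.f x (X x)) (Y x) := by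
  have h1 := hS.dη_eq i X Y hX hY x
  have h2 := hS.dη_eq i Y X hY hX x
  rw [g.symm x (S.f x (X x))]
  simp only [extDerivOneForm, Phi] at h1 h2
  rw [VectorField.mlieBracket_swap_apply, map_neg] at h2
  rw [← h1, ← h2]
  ring

/-- The structure equation only gives `f² ξ_i = 0`; skewness then makes `|f ξ_i|² = -g(ξ_i, f² ξ_i)`
vanish. -/
theorem f_ξ (i : Fin s) (x : M) : S.f x (S.ξ i x) = 0 := by
  have hsq : S.f x (S.f x (S.ξ i x)) = 0 := by
    rw [S.f_sq, S.Q_ξ]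
    simp [S.η_ξ]
  have h := hS.inner_f_right i (S.smooth_ξ i) (S.smooth_f_apply (S.smooth_ξ i)) x
  simp only [applyEndo, hsq, map_zero] at h
  by_contra hne
  exact (g.pos x _ hne).ne (by linarith)

theorem inner_ξ_right (i : Fin s) (x : M) (v : TangentSpace I x) :
    g.inner x v (S.ξ i x) = S.η i x v := by
  have h := hS.compatible x v (S.ξ i x)
  rw [hS.f_ξ, S.Q_ξ] at h
  simp [S.η_ξ] at h
  linarith

theorem η_f (i : Fin s) {X : VField I M} (hX : SmoothVField I X) (x : M) :
    S.η i x (S.f x (X x)) = 0 := by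
  have h := hS.inner_f_right i hX (S.smooth_ξ i) x
  rw [hS.f_ξ, map_zero, hS.inner_ξ_right] at h
  linarith

/-- This is `£_{ξ_i} η^k = 0`: the contraction `dη^k(ξ_i, X) = g(ξ_i, fX) = η^i(fX)` vanishes and
`η^k(ξ_i)` is constant. -/
theorem mvfderiv_η (i k : Fin s) {X : VField I M} (hX : SmoothVField I X) (x : M) :
    mvfderiv I (fun y ↦ S.η k y (X y)) x (S.ξ i x) =
      S.η k x (VectorField.mlieBracket I (S.ξ i) X x) := by
  have h := hS.dη_eq k (S.ξ i) X (S.smooth_ξ i) hX x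
  simp only [extDerivOneForm, Phi, S.η_ξ, mvfderiv_const] at h
  rw [g.symm, hS.inner_ξ_right, hS.η_f i hX] at h
  simp at h
  linarith

variable [CompleteSpace E]

/-- The fundamental form is invariant along the structure vector fields. -/
theorem mvfderiv_Phi (i : Fin s) {X Y : VField I M} (hX : SmoothVField I X)
    (hY : SmoothVField I Y) (x : M) :
    mvfderiv I (fun y ↦ g.inner y (X y) (S.f y (Y y))) x (S.ξ i x) =
      g.inner x (VectorField.mlieBracket I (S.ξ i) X x) (S.f x (Y x))
        + g.inner x (X x) (S.f x (VectorField.mlieBracket I (S.ξ i) Y x)) := by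
  have hξ := S.smooth_ξ i
  have hη : ∀ {W : VField I M}, SmoothVField I W → ContMDiff I 𝓘(ℝ) ∞ (fun y ↦ S.η i y (W y)) :=
    S.smooth_η_apply i
  have hs : ∀ {W : VField I M} {u : M → ℝ}, SmoothVField I W → ContMDiff I 𝓘(ℝ) ∞ u →
      ContMDiff I 𝓘(ℝ) ∞ (fun y ↦ mvfderiv I u y (W y)) := fun hW hu ↦
    contMDiff_mvfderiv_apply (S.smooth_η i) hξ (S.η_ξ_self i) hW hu
  have hd : ∀ {a : M → ℝ}, ContMDiff I 𝓘(ℝ) ∞ a → MDiffAt a x := fun ha ↦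
    ha.mdifferentiable (by simp) x
  have hf : (fun y ↦ g.inner y (X y) (S.f y (Y y))) = fun y ↦ extDerivOneForm I (S.η i) X Y y :=
    funext fun y ↦ (hS.dη_eq i X Y hX hY y).symm
  have h1 := hS.dη_eq i _ Y (hξ.mlieBracket hX) hY x
  have h2 := hS.dη_eq i X _ hX (hξ.mlieBracket hY) x
  simp only [Phi] at h1 h2
  rw [hf, ← h1, ← h2]
  -- The identity `£_ξ dη = d £_ξ η = 0` by hand: `c1` and `c2` commute `ξ` past `X` and `Y`, while
  -- `d1` handles `η([X, Y])` by Jacobi.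
  have c1 := mvfderiv_mlieBracket (S.smooth_η i) hξ (S.η_ξ_self i) hξ hX (hη hY) x
  have c2 := mvfderiv_mlieBracket (S.smooth_η i) hξ (S.η_ξ_self i) hξ hY (hη hX) x
  have d1 := hS.mvfderiv_η i i (hX.mlieBracket hY) x
  simp only [hS.mvfderiv_η i i hX, hS.mvfderiv_η i i hY] at c1 c2
  rw [leibniz_mlieBracket hξ hX hY, Pi.add_apply, map_add] at d1
  simp only [extDerivOneForm]
  have e : mvfderiv I (fun y ↦ (1 / 2 : ℝ) * (mvfderiv I (fun z ↦ S.η i z (Y z)) y (X y)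
      - mvfderiv I (fun z ↦ S.η i z (X z)) y (Y y)
      - S.η i y (VectorField.mlieBracket I X Y y))) x (S.ξ i x) =
      (1 / 2 : ℝ) * (mvfderiv I (fun y ↦ mvfderiv I (fun z ↦ S.η i z (Y z)) y (X y)) x (S.ξ i x)
      - mvfderiv I (fun y ↦ mvfderiv I (fun z ↦ S.η i z (X z)) y (Y y)) x (S.ξ i x)
      - mvfderiv I (fun y ↦ S.η i y (VectorField.mlieBracket I X Y y)) x (S.ξ i x)) := by
    have a1 := hs hX (hη hY)
    have a2 := hs hY (hη hX)
    have a3 := hη (hX.mlieBracket hY)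
    rw [mvfderiv_fun_mul mdifferentiableAt_const (hd ((a1.sub a2).sub a3)),
      mvfderiv_fun_sub (hd (a1.sub a2)) (hd a3), mvfderiv_fun_sub (hd a1) (hd a2)]
    simp [mvfderiv_const]
  rw [e, d1]
  linarith

theorem mlieBracket_ξ (i k : Fin s) (x : M) :
    VectorField.mlieBracket I (S.ξ i) (S.ξ k) x = 0 := by
  have hb := (S.smooth_ξ i).mlieBracket (S.smooth_ξ k)
  have hη : ∀ l, S.η l x (VectorField.mlieBracket I (S.ξ i) (S.ξ k) x) = 0 := by
    intro l
    rw [← hS.mvfderiv_η i l (S.smooth_ξ k)]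
    simp [S.η_ξ, mvfderiv_const]
  have hf : S.f x (VectorField.mlieBracket I (S.ξ i) (S.ξ k) x) = 0 := by
    -- With `f[ξ_i, ξ_k]` and `ξ_k` as arguments of `Φ`, every term containing `f ξ_k` drops out,
    -- leaving `|f[ξ_i, ξ_k]|² = 0`.
    have h := hS.mvfderiv_Phi i (S.smooth_f_apply hb) (S.smooth_ξ k) x
    simp only [hS.f_ξ, map_zero, mvfderiv_const, zero_add, zero_apply] at h
    by_contra hne
    exact (g.pos x _ hne).ne h
  have h := S.f_sq x (VectorField.mlieBracket I (S.ξ i) (S.ξ k) x)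
  simp only [hf, hη, map_zero, zero_smul, Finset.sum_const_zero, add_zero] at h
  exact S.Q_injective x (by rw [map_zero]; exact neg_eq_zero.1 h.symm)

end IsWeakAlmostS
end Structure
end FramedWeakFStructure

/-! ### Algebra of the structure operators -/

/-- The algebraic relations between the operators `f`, `q`, `p = q⁻¹` and the Lie derivatives `l`
along the structure vector fields. -/
structure WeakFRelations {R ι : Type*} [Ring R] (f q p : R) (l : ι → R) : Prop where
  pq : p * q = 1
  qp : q * p = 1
  f_mul : f * (f * f + q) = 0
  mul_f : (f * f + q) * f = 0
  l_q : ∀ i, l i * q = q * l i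
  l_sq : ∀ i, l i * (f * f + q) = (f * f + q) * l i

namespace WeakFRelations

variable {R ι : Type*} [Ring R] {f q p : R} {l h A : ι → R}
  (r : WeakFRelations f q p l) (hh : ∀ i, l i * f - f * l i = h i + h i)
  (hA : ∀ i, A i = - f + h i * (p * f)) [IsAddTorsionFree R]

include r

omit [IsAddTorsionFree R] in
theorem commute_q_f : Commute q f := by
  have h1 := r.f_mul
  have h2 := r.mul_f
  have : q * f = f * q := by
    linear_combination (norm := noncomm_ring) h2 - h1
  exact this

omit [IsAddTorsionFree R] in
theorem commute_p_of_commute_q {a : R} (h : Commute q a) : Commute p a := by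
  have : p * a * (q * p) = (p * q) * a * p := by
    rw [mul_assoc p q a, h.eq]; noncomm_ring
  rwa [r.qp, r.pq, mul_one, one_mul] at this

include hh

theorem commute_q_h (i : ι) : Commute q (h i) := by
  have h1 := r.commute_q_f.eq
  have h2 := r.l_q i
  have h3 := hh i
  have : (2 : ℕ) • (q * h i) = (2 : ℕ) • (h i * q) := by
    linear_combination (norm := noncomm_ring)
      h3 * q - q * h3 + l i * h1 - h1 * l i + f * h2 - h2 * f
  exact nsmul_right_injective two_ne_zero this

/-- Both `f² + q` and `q` commute with `l i`, hence so does `f²`; its commutator with `l i` is `2 (h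
i * f + f * h i)`. -/
theorem h_mul_f (i : ι) : h i * f = - (f * h i) := by
  have h1 := r.l_sq i
  have h2 := r.l_q i
  have h3 := hh i
  have : (2 : ℕ) • (h i * f) = (2 : ℕ) • (- (f * h i)) := by
    linear_combination (norm := noncomm_ring) h1 - h2 - h3 * f - f * h3
  exact nsmul_right_injective two_ne_zero this

/-- The projection `f² + q` kills `f` from the left and commutes with `l i`, so it kills `[l i, f] =
2 h i`. -/
theorem f_mul_f_mul_h (i : ι) : f * (f * h i) = - (q * h i) := by
  have h1 := r.l_sq i
  have h2 := r.mul_f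
  have h3 := hh i
  have : (2 : ℕ) • (f * (f * h i)) = (2 : ℕ) • (- (q * h i)) := by
    linear_combination (norm := noncomm_ring) l i * h2 - h1 * f  - (f * f + q) * h3 - h2 * l i
  exact nsmul_right_injective two_ne_zero this

theorem f_mul_f_mul_deriv (i j : ι) :
    f * (f * (l i * h j - h j * l i)) = - (q * (l i * h j - h j * l i)) := by
  have h1 := r.l_sq i
  have h2 := r.f_mul_f_mul_h hh j
  linear_combination (norm := noncomm_ring) l i * h2 - h2 * l i - h1 * h j

/-- The commutator with `l i` applied to `h j * f = -(f * h j)`. -/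
theorem deriv_mul_f (i j : ι) :
    (l i * h j - h j * l i) * f =
      - (f * (l i * h j - h j * l i)) - 2 * (h j * h i + h i * h j) := by
  have h1 := r.h_mul_f hh j
  have h3 := hh i
  linear_combination (norm := noncomm_ring) l i * h1 - h1 * l i - h j * h3 - h3 * h j

include hA

theorem A_eq (k : ι) : A k = - f - p * (f * h k) := by
  have ph := (r.commute_p_of_commute_q (r.commute_q_h hh k)).eq
  rw [hA, ← mul_assoc, ← ph, mul_assoc, r.h_mul_f hh]
  noncomm_ring

/-- In the expanded product, `f² h = -q h` and `f h f = q h` create factors `q` that cancel against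
`p`. -/
theorem A_mul_A (i j : ι) : A i * A j = f * f - h j + h i + p * (h i * h j) := by
  have pf := (r.commute_p_of_commute_q r.commute_q_f).eq
  have ph := fun k ↦ (r.commute_p_of_commute_q (r.commute_q_h hh k)).eq
  have e1 : f * h i * f = q * h i := by
    linear_combination (norm := noncomm_ring) f * r.h_mul_f hh i - r.f_mul_f_mul_h hh i
  have e2 := r.f_mul_f_mul_h hh j
  have e3 := r.pq
  rw [r.A_eq hh hA, r.A_eq hh hA]
  linear_combination (norm := noncomm_ring)
    - pf * f * h j + p * e2 - e3 * h j + p * e1 + e3 * h i - p * f * ph i * f * h j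
      - p * pf * h i * f * h j + p * p * e1 * h j + p * e3 * h i * h j

/-- The curvature operator `R_{ξ_i, ·} ξ_j`. -/
theorem curvature_eq (i j : ι) :
    l i * A j - A j * l i + A i * A j =
      f * f - h i - h j - p * (h i * h j) - p * (f * (l i * h j - h j * l i)) := by
  have pf := (r.commute_p_of_commute_q r.commute_q_f).eq
  have ph := (r.commute_p_of_commute_q (r.commute_q_h hh j)).eq
  have pl := (r.commute_p_of_commute_q (r.l_q i).symm).eq
  have h3 := hh i
  have e1 := r.deriv_mul_f hh i j
  rw [r.A_mul_A hh hA, hA]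
  linear_combination (norm := noncomm_ring) - h3 - l i * ph * f - pl * h j * f + ph * f * l i
    + p * e1 + p * h j * h3

/-- Multiplying the curvature by `f` recovers `D = l i * h j - h j * l i`, because `-f p f D = -p f²
D = D`. -/
theorem nabla_h (i j : ι) :
    (l i + A i) * h j - h j * (l i + A i) =
      f * (l i * A j - A j * l i + A i * A j) + f * h i - f * h j + q * f
        - f * (p * (h j * h i)) := by
  have pf := (r.commute_p_of_commute_q r.commute_q_f).eq
  have ph := fun k ↦ (r.commute_p_of_commute_q (r.commute_q_h hh k)).eq
  have e1 := r.f_mul_f_mul_deriv hh i j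
  have e2 := r.mul_f
  have e3 := fun k ↦ r.h_mul_f hh k
  have e4 := r.pq
  rw [r.curvature_eq hh hA, r.A_eq hh hA]
  linear_combination (norm := noncomm_ring) e3 j - e2 - pf * f * (l i * h j - h j * l i)
    + p * e1 - e4 * (l i * h j - h j * l i) - pf * h i * h j - ph j * f * h i
    + p * e3 j * h i - pf * h j * h i

/-- The derivative `D = l i * h j - h j * l i` disappears: it contributes `-f D` and `f p f D f = -D
f`, whose sum is `2 (h j * h i + h i * h j)` by `deriv_mul_f`. The `h i * h j` part then cancels
against the quadratic term of the curvature. -/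
theorem curvature_sub (i j : ι) :
    q * (l i * A j - A j * l i + A i * A j) - f * (l i * A j - A j * l i + A i * A j) * f =
      2 * (h j * h i + q * (f * f)) := by
  have e1 := r.f_mul_f_mul_deriv hh i j
  have e2 := r.mul_f
  have e3 := fun k ↦ r.h_mul_f hh k
  have e4 := r.pq
  have e5 := r.qp
  have e6 := fun k ↦ r.f_mul_f_mul_h hh k
  have e7 := r.deriv_mul_f hh i j
  have pf := (r.commute_p_of_commute_q r.commute_q_f).eq
  rw [r.curvature_eq hh hA]
  generalize l i * h j - h j * l i = D at *
  have e8 : ∀ k, f * h k * f = q * h k := fun k ↦ by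
    linear_combination (norm := noncomm_ring) f * e3 k - e6 k
  have e9 : f * (p * (h i * h j)) * f = - (h i * h j) := by
    linear_combination (norm := noncomm_ring) - pf * h i * h j * f + p * f * h i * e3 j
      - p * e8 i * h j - e4 * h i * h j
  have e10 : f * (p * (f * D)) * f = f * D + 2 * (h j * h i + h i * h j) := by
    linear_combination (norm := noncomm_ring) - pf * f * D * f + p * e1 * f - e4 * D * f - e7
  linear_combination (norm := noncomm_ring) e8 i + e8 j + e9 + e10 - e2 * f
    - e5 * h i * h j - e5 * f * D

end WeakFRelations

/-! ### The covariant derivative of the structure vector fields -/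

namespace FramedWeakFStructure
namespace IsWeakAlmostS

section LeviCivita

variable {E : Type*} [NormedAddCommGroup E] [NormedSpace ℝ E]
  {H : Type*} [TopologicalSpace H] {I : ModelWithCorners ℝ E H}
  {M : Type*} [TopologicalSpace M] [ChartedSpace H M] [IsManifold I ∞ M] {n s : ℕ}
  {S : FramedWeakFStructure I M n s} {g : RMetric I M} (hS : S.IsWeakAlmostS g)
  {nabla : CovariantDerivative I E (TangentSpace I : M → Type _)} (hn : g.IsLeviCivita nabla)

include hn in
theorem _root_.RMetric.IsLeviCivita.apply_eq_mlieBracket_add {X Y : VField I M}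
    (hX : SmoothVField I X) (hY : SmoothVField I Y) (x : M) :
    nabla Y x (X x) = VectorField.mlieBracket I X Y x + nabla X x (Y x) :=
  sub_eq_iff_eq_add.1 (hn X Y x (hX.mdiffAt x) (hY.mdiffAt x)).1

include hS hn

/-- `∇ξ_i` splits into its skew part `-f` and its symmetric part, half of `£_{ξ_i} g`. -/
theorem two_mul_inner_nabla_ξ (i : Fin s) {X Z : VField I M} (hX : SmoothVField I X)
    (hZ : SmoothVField I Z) (x : M) :
    2 * g.inner x (nabla (S.ξ i) x (X x)) (Z x) =
      2 * g.inner x (X x) (S.f x (Z x))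
        + (mvfderiv I (fun y ↦ g.inner y (X y) (Z y)) x (S.ξ i x)
          - g.inner x (VectorField.mlieBracket I (S.ξ i) X x) (Z x)
          - g.inner x (X x) (VectorField.mlieBracket I (S.ξ i) Z x)) := by
  have hξ := S.smooth_ξ i
  have m1 := (hn X Z x (hX.mdiffAt x) (hZ.mdiffAt x)).2 (S.ξ i x)
  rw [hn.apply_eq_mlieBracket_add hξ hX, hn.apply_eq_mlieBracket_add hξ hZ] at m1
  simp only [map_add, add_apply] at m1
  -- As `g(·, ξ_i) = η^i`, the left sides of `m2` and `m3` are the derivative terms of `dη^i(X, Z) =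
  -- g(X, fZ)`.
  have m2 := (hn Z (S.ξ i) x (hZ.mdiffAt x) (hξ.mdiffAt x)).2 (X x)
  have m3 := (hn X (S.ξ i) x (hX.mdiffAt x) (hξ.mdiffAt x)).2 (Z x)
  have t := hn.apply_eq_mlieBracket_add hX hZ x
  have d := hS.dη_eq i X Z hX hZ x
  simp only [hS.inner_ξ_right] at m2 m3
  rw [t, map_add] at m2
  simp only [extDerivOneForm, Phi] at d
  rw [g.symm x (X x) (nabla (S.ξ i) x (Z x))] at m1 m3
  rw [g.symm x (Z x) (nabla (S.ξ i) x (X x))] at m2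
  linarith

variable [CompleteSpace E] [FiniteDimensional ℝ E] [T2Space M]

/-- On the image of `f` the symmetric part of `∇ξ_i` is known: `£_{ξ_i} Φ = 0` gives `(£_{ξ_i} g)(Z,
fW) = -2 g(Z, h_i W)`. -/
theorem nabla_ξ_f (i : Fin s) {W : VField I M} (hW : SmoothVField I W) (x : M) :
    nabla (S.ξ i) x (S.f x (W x)) = - S.f x (S.f x (W x)) - S.h i W x := by
  have hξ := S.smooth_ξ i
  have hfW := S.smooth_f_apply hW
  refine g.ext_inner fun w ↦ ?_
  obtain ⟨Z, hZ, rfl⟩ := SmoothVField.exists_eq w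
  have h1 := hS.two_mul_inner_nabla_ξ hn i hfW hZ x
  have h2 := hS.mvfderiv_Phi i hZ hW x
  have h3 := hS.inner_f_right i hfW hZ x
  simp only [applyEndo] at h1 h3
  rw [g.d_symm (fun y ↦ S.f y (W y)), h2, g.symm x (Z x), g.symm x _ (S.f x (W x))] at h1
  simp only [h, lieDerivEndo, Pi.smul_apply, map_sub, map_neg, map_smul, sub_apply, neg_apply,
    smul_apply, smul_eq_mul]
  linarith

/-- Both parts of `∇ξ_i` vanish on `ξ_k`: the skew one by `η^k ∘ f = 0`, the symmetric one by
`£_{ξ_i} η^k = 0` and `[ξ_i, ξ_k] = 0`. -/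
theorem nabla_ξ_ξ (i k : Fin s) (x : M) : nabla (S.ξ i) x (S.ξ k x) = 0 := by
  refine g.ext_inner fun w ↦ ?_
  obtain ⟨Z, hZ, rfl⟩ := SmoothVField.exists_eq w
  have h1 := hS.two_mul_inner_nabla_ξ hn i (S.smooth_ξ k) hZ x
  rw [g.d_symm (S.ξ k), g.symm x _ (S.f x (Z x)), g.symm x (S.ξ k x)] at h1
  simp only [hS.inner_ξ_right, hS.η_f k hZ, hS.mvfderiv_η i k hZ, hS.mlieBracket_ξ, map_zero,
    zero_apply] at h1
  rw [map_zero, zero_apply]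
  linarith

end LeviCivita
end IsWeakAlmostS
end FramedWeakFStructure

noncomputable section


/-! ### Operators on smooth vector fields -/

section Operators

variable {E : Type*} [NormedAddCommGroup E] [NormedSpace ℝ E]
  {H : Type*} [TopologicalSpace H] {I : ModelWithCorners ℝ E H}
  {M : Type*} [TopologicalSpace M] [ChartedSpace H M] [IsManifold I ∞ M]

variable (I M) in
/-- The real vector space of smooth vector fields. -/
abbrev SmoothVFields : Type _ := Cₛ^∞⟮I; E, (TangentSpace I : M → Type _)⟯

theorem SmoothVFields.sum_apply {ι : Type*} (t : Finset ι) (Y : ι → SmoothVFields I M) (x : M) :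
    (∑ k ∈ t, Y k) x = ∑ k ∈ t, Y k x := by
  have h := map_sum (ContMDiffSection.coeAddHom I E ∞ (TangentSpace I : M → Type _)) Y t
  have := congrFun h x
  rwa [Finset.sum_apply] at this

/-- A smooth field of endomorphisms as an operator on smooth vector fields. -/
def endoOp (T : Π x : M, TangentSpace I x →L[ℝ] TangentSpace I x)
    (hT : ContMDiff I (I.prod 𝓘(ℝ, E →L[ℝ] E)) ∞ (fun x ↦ TotalSpace.mk' (E →L[ℝ] E)
      (E := fun x : M ↦ TangentSpace I x →L[ℝ] TangentSpace I x) x (T x))) :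
    Module.End ℝ (SmoothVFields I M) where
  toFun X := ⟨applyEndo I T X, SmoothVField.applyEndo hT X.contMDiff⟩
  map_add' X Y := by ext x; exact map_add (T x) _ _
  map_smul' c X := by ext x; exact map_smul (T x) _ _

/-- The Lie derivative along a smooth vector field as an operator on smooth vector fields. -/
def lieOp [CompleteSpace E] (ξ : VField I M) (hξ : SmoothVField I ξ) :
    Module.End ℝ (SmoothVFields I M) where
  toFun X := ⟨VectorField.mlieBracket I ξ X, hξ.mlieBracket X.contMDiff⟩
  map_add' X Y := by
    ext x
    exact VectorField.mlieBracket_add_right X.mdifferentiableAt Y.mdifferentiableAt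
  map_smul' c X := by
    ext x
    exact VectorField.mlieBracket_const_smul_right X.mdifferentiableAt

end Operators

/-! ### The structure, connection and curvature in the ring of operators -/

namespace FramedWeakFStructure

variable {E : Type*} [NormedAddCommGroup E] [NormedSpace ℝ E] [CompleteSpace E]
  {H : Type*} [TopologicalSpace H] {I : ModelWithCorners ℝ E H}
  {M : Type*} [TopologicalSpace M] [ChartedSpace H M] [IsManifold I ∞ M] {n s : ℕ}
  (S : FramedWeakFStructure I M n s)

def fOp : Module.End ℝ (SmoothVFields I M) := endoOp S.f S.smooth_f

def qOp : Module.End ℝ (SmoothVFields I M) := endoOp S.Q S.smooth_Q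

def pOp : Module.End ℝ (SmoothVFields I M) :=
  endoOp (fun x ↦ (S.Q x).inverse) (contMDiff_inverse_endo S.smooth_Q S.nonsingular_Q)

def lOp (i : Fin s) : Module.End ℝ (SmoothVFields I M) := lieOp (S.ξ i) (S.smooth_ξ i)

def hOp (i : Fin s) : Module.End ℝ (SmoothVFields I M) :=
  (1 / 2 : ℝ) • (S.lOp i * S.fOp - S.fOp * S.lOp i)

/-- The operator `X ↦ ∇_X ξ_i`. -/
def aOp (i : Fin s) : Module.End ℝ (SmoothVFields I M) :=
  - S.fOp + S.hOp i * (S.pOp * S.fOp)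

variable (X : SmoothVFields I M) (x : M)

omit [CompleteSpace E] in
theorem fOp_apply : S.fOp X x = S.f x (X x) := rfl

theorem lOp_apply (i : Fin s) : S.lOp i X x = VectorField.mlieBracket I (S.ξ i) X x := rfl

theorem coe_hOp (i : Fin s) : ⇑(S.hOp i X) = S.h i X := rfl

omit [CompleteSpace E] in
theorem projection_apply :
    (S.fOp * S.fOp + S.qOp) X x = ∑ k, S.η k x (X x) • S.ξ k x := by
  change S.f x (S.f x (X x)) + S.Q x (X x) = _
  rw [S.f_sq]
  abel

namespace IsWeakAlmostS

variable {S} {g : RMetric I M} (hS : S.IsWeakAlmostS g)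
include hS

theorem weakFRelations (hQ : S.LieDerivQEqZero) :
    WeakFRelations S.fOp S.qOp S.pOp S.lOp where
  pq := by
    ext X x
    exact (S.nonsingular_Q x).inverse_apply_self _
  qp := by
    ext X x
    exact (S.nonsingular_Q x).self_apply_inverse _
  f_mul := by
    ext X x
    change S.f x ((S.fOp * S.fOp + S.qOp) X x) = 0
    rw [projection_apply]
    simp [hS.f_ξ]
  mul_f := by
    ext X x
    change (S.fOp * S.fOp + S.qOp) (S.fOp X) x = 0
    rw [projection_apply]
    exact Finset.sum_eq_zero fun k _ ↦ by rw [fOp_apply, hS.η_f k X.contMDiff, zero_smul]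
  l_q i := by
    ext X x
    exact sub_eq_zero.1 (congrFun (hQ i X X.contMDiff) x)
  l_sq i := by
    ext X x
    have hη : ∀ k, ContMDiff I 𝓘(ℝ) ∞ (fun y ↦ S.η k y (X y)) :=
      fun k ↦ S.smooth_η_apply k X.contMDiff
    let Y : Fin s → SmoothVFields I M := fun k ↦
      ⟨(fun y ↦ S.η k y (X y)) • S.ξ k, (S.smooth_ξ k).smul (hη k)⟩
    have hX : (S.fOp * S.fOp + S.qOp) X = ∑ k, Y k := by
      ext y
      rw [projection_apply, SmoothVFields.sum_apply]
      rfl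
    change S.lOp i ((S.fOp * S.fOp + S.qOp) X) x = (S.fOp * S.fOp + S.qOp) (S.lOp i X) x
    rw [projection_apply, hX, map_sum, SmoothVFields.sum_apply]
    -- By Leibniz, `[ξ_i, η^k(X) ξ_k] = η^k([ξ_i, X]) ξ_k`, since `£_{ξ_i} η^k = 0` and `[ξ_i, ξ_k]
    -- = 0`.
    refine Finset.sum_congr rfl fun k _ ↦ ?_
    refine (VectorField.mlieBracket_smul_right ((hη k).mdifferentiable (by simp) x)
      ((S.smooth_ξ k).mdiffAt x)).trans ?_
    rw [hS.mlieBracket_ξ, smul_zero, add_zero, hS.mvfderiv_η i k X.contMDiff, lOp_apply]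

variable [FiniteDimensional ℝ E] [T2Space M]
  {nabla : CovariantDerivative I E (TangentSpace I : M → Type _)} (hn : g.IsLeviCivita nabla)
include hn

theorem nabla_ξ (hQ : S.LieDerivQEqZero) (i : Fin s) (X : SmoothVFields I M) (x : M) :
    nabla (S.ξ i) x (X x) = S.aOp i X x := by
  have r := hS.weakFRelations hQ
  have pf : S.pOp * S.fOp = S.fOp * S.pOp := r.commute_p_of_commute_q r.commute_q_f
  -- This splits `X` into a combination of the `ξ_k`, where `∇ξ_i` vanishes, and `-f(Q⁻¹ f X)`,
  -- where `nabla_ξ_f` applies.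
  have h1 : (S.fOp * S.fOp + S.qOp) * S.pOp - S.fOp * (S.pOp * S.fOp) = 1 := by
    linear_combination (norm := noncomm_ring) r.qp - S.fOp * pf
  have h2 : S.aOp i = S.fOp * (S.fOp * (S.pOp * S.fOp)) + S.hOp i * (S.pOp * S.fOp) := by
    rw [aOp]
    linear_combination (norm := noncomm_ring) S.fOp * pf * S.fOp + pf * S.fOp * S.fOp
      - S.pOp * r.mul_f + r.pq * S.fOp
  have h3 : nabla (S.ξ i) x ((S.fOp * S.fOp + S.qOp) (S.pOp X) x) = 0 := by
    rw [projection_apply]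
    simp [hS.nabla_ξ_ξ hn]
  have h4 := hS.nabla_ξ_f hn i ((S.pOp * S.fOp) X).contMDiff x
  have h5 : X x = (S.fOp * S.fOp + S.qOp) (S.pOp X) x - S.f x ((S.pOp * S.fOp) X x) :=
    (congrArg (fun A : Module.End ℝ (SmoothVFields I M) ↦ A X x) h1).symm
  rw [h5, map_sub, h3, h4, h2, zero_sub, neg_sub, sub_neg_eq_add, add_comm]
  rfl

theorem nabla_along_ξ (hQ : S.LieDerivQEqZero) (i : Fin s) (X : SmoothVFields I M)  :
    covDeriv nabla (S.ξ i) X = ⇑((S.lOp i + S.aOp i) X) := by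
  ext x
  exact (hn.apply_eq_mlieBracket_add (S.smooth_ξ i) X.contMDiff x).trans
    (congrArg _ (hS.nabla_ξ hn hQ i X x))

/-- The term `∇_X ∇_{ξ_i} ξ_j` is zero, and `∇_{ξ_i}` acts as `lOp i + aOp i`. -/
theorem curvature_ξ (hQ : S.LieDerivQEqZero) (i j : Fin s) (X : SmoothVFields I M)  :
    curvature nabla (S.ξ i) X (S.ξ j) =
      ⇑((S.lOp i * S.aOp j - S.aOp j * S.lOp i + S.aOp i * S.aOp j) X) := by
  have h1 : covDeriv nabla X (S.ξ j) = ⇑(S.aOp j X) :=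
    funext fun x ↦ hS.nabla_ξ hn hQ j X x
  have h2 : covDeriv nabla (S.ξ i) (S.ξ j) = 0 := funext fun x ↦ hS.nabla_ξ_ξ hn j i x
  have h3 : covDeriv nabla (VectorField.mlieBracket I (S.ξ i) X) (S.ξ j) =
      ⇑(S.aOp j (S.lOp i X)) := funext fun x ↦ hS.nabla_ξ hn hQ j (S.lOp i X) x
  have h4 : covDeriv nabla X 0 = 0 := by
    ext x
    change nabla 0 x (X x) = 0
    rw [nabla.zero]
    rfl
  have h5 : S.lOp i * S.aOp j - S.aOp j * S.lOp i + S.aOp i * S.aOp j =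
      (S.lOp i + S.aOp i) * S.aOp j - S.aOp j * S.lOp i := by noncomm_ring
  rw [curvature, h1, h2, h3, h4, hS.nabla_along_ξ hn hQ, h5, sub_zero]
  rfl

theorem covDerivEndo_h (hQ : S.LieDerivQEqZero) (i j : Fin s) (X : SmoothVFields I M) :
    covDerivEndo nabla (S.ξ i) (S.h j) X =
      ⇑(((S.lOp i + S.aOp i) * S.hOp j - S.hOp j * (S.lOp i + S.aOp i)) X) := by
  rw [covDerivEndo, ← coe_hOp, hS.nabla_along_ξ hn hQ, hS.nabla_along_ξ hn hQ, ← coe_hOp]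
  rfl

end IsWeakAlmostS
end FramedWeakFStructure

end

theorem mainTheorem8
    {E : Type*} [NormedAddCommGroup E] [NormedSpace ℝ E] [FiniteDimensional ℝ E] [CompleteSpace E]
    {H : Type*} [TopologicalSpace H] {I : ModelWithCorners ℝ E H} [I.Boundaryless]
    {M : Type*} [TopologicalSpace M] [T2Space M] [SecondCountableTopology M]
    [ChartedSpace H M] [IsManifold I ∞ M]
    {n s : ℕ} (hn : 0 < n) (hs : 0 < s) (hdim : Module.finrank ℝ E = 2 * n + s)
    (g : RMetric I M) (S : FramedWeakFStructure I M n s)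
    (hS : S.IsWeakAlmostS g) (hQ : S.LieDerivQEqZero)
    (i j : Fin s) (X : VField I M) (hX : SmoothVField I X) (x : M) :
    (covDerivEndo g.leviCivita (S.ξ i) (S.h j) X x =
      S.f x (curvature g.leviCivita (S.ξ i) X (S.ξ j) x)
        + S.f x (S.h i X x) - S.f x (S.h j X x)
        + S.Q x (S.f x (X x)) - S.f x ((S.Q x).inverse (S.h j (S.h i X) x))) ∧
    (covDerivEndo g.leviCivita (S.ξ i) (S.h i) X x =
      S.f x (curvature g.leviCivita (S.ξ i) X (S.ξ i) x)
        + S.Q x (S.f x (X x)) - S.f x ((S.Q x).inverse (S.h i (S.h i X) x))) ∧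
    (S.Q x (curvature g.leviCivita (S.ξ i) X (S.ξ j) x)
        - S.f x (curvature g.leviCivita (S.ξ i) (applyEndo I S.f X) (S.ξ j) x) =
      (2 : ℝ) • (S.h j (S.h i X) x + S.Q x (S.f x (S.f x (X x))))) ∧
    (S.Q x (curvature g.leviCivita (S.ξ i) X (S.ξ i) x)
        - S.f x (curvature g.leviCivita (S.ξ i) (applyEndo I S.f X) (S.ξ i) x) =
      (2 : ℝ) • (S.h i (S.h i X) x + S.Q x (S.f x (S.f x (X x))))) := by
  have hn := g.isLeviCivita_leviCivita
  have r := hS.weakFRelations hQ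
  have hh : ∀ k, S.lOp k * S.fOp - S.fOp * S.lOp k = S.hOp k + S.hOp k := fun k ↦ by
    rw [FramedWeakFStructure.hOp, ← add_smul]
    norm_num
  obtain ⟨Y, rfl⟩ : ∃ Y : SmoothVFields I M, ⇑Y = X := ⟨⟨X, hX⟩, rfl⟩
  have : IsAddTorsionFree (Module.End ℝ (SmoothVFields I M)) := 
    .of_isTorsionFree ℝ _
  have ev : ∀ {A B : Module.End ℝ (SmoothVFields I M)}, A = B → A Y x = B Y x := fun h ↦ by rw [h]
  have first : ∀ k, covDerivEndo g.leviCivita (S.ξ i) (S.h k) Y x =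
      S.f x (curvature g.leviCivita (S.ξ i) Y (S.ξ k) x)
        + S.f x (S.h i Y x) - S.f x (S.h k Y x)
        + S.Q x (S.f x (Y x)) - S.f x ((S.Q x).inverse (S.h k (S.h i Y) x)) := fun k ↦ by
    rw [congrFun (hS.covDerivEndo_h hn hQ i k Y) x, congrFun (hS.curvature_ξ hn hQ i k Y) x]
    exact ev (r.nabla_h hh (fun _ ↦ rfl) i k)
  have second : ∀ k, S.Q x (curvature g.leviCivita (S.ξ i) Y (S.ξ k) x)
        - S.f x (curvature g.leviCivita (S.ξ i) (applyEndo I S.f Y) (S.ξ k) x) =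
      (2 : ℝ) • (S.h k (S.h i Y) x + S.Q x (S.f x (S.f x (Y x)))) := fun k ↦ by
    have hf : applyEndo I S.f Y = ⇑(S.fOp Y) := rfl
    rw [hf, congrFun (hS.curvature_ξ hn hQ i k Y) x,
      congrFun (hS.curvature_ξ hn hQ i k (S.fOp Y)) x, two_smul]
    exact ev ((r.curvature_sub hh (fun _ ↦ rfl) i k).trans (two_mul _))
  refine ⟨first j, ?_, second j, second i⟩
  -- For equal indices the two terms `f h_i X` cancel.
  rw [first i]
  abel
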